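/- Let $m,N\ge 0$ be integers and let $\mathcal S\subseteq\{1,\dots,N\}$. Let $\mathcal U$ be the set of all real $m\times N$ matrices whose columns $A_{\bullet 1},\dots,A_{\bullet N}$ have Euclidean norm $1$. Identify $\mathcal U$ with the product of $N$ copies of the unit sphere of $\mathbb R^m$, and let $\mu$ be the product of the surface measures of these spheres. Given $A\in\mathbb R^{m\times N}$ and $y\in\mathbb R^m$, a sequence generated by orthogonal matching pursuit (OMP) starts with $x^0=0$, $\mathcal J_0=\emptyset$, and for $k=0,1,2,\dots$ chooses arbitrarily $$j^*_{k+1}\in\operatorname*{Argmin}_{1\le j\le N}\ \min_{t\in\mathbb R}\|y-A(x^k+t\mathbf e_j)\|_2^2,\qquad \mathcal J_{k+1}=\mathcal J_k\cup\{j^*_{k+1}\},\qquad x^{k+1}\in\operatorname*{Argmin}_{\operatorname{supp}(w)\subseteq\mathcal J_{k+1}}\|Aw-y\|_2^2 .$$ A matrix $A$ achieves exact vector recovery for the support $\mathcal S$ if, for every $z\in\mathbb R^N$ with $\operatorname{supp}(z)=\mathcal S$ and along every sequence generated by OMP from $y=Az$, there is an index $s$ with $\mathcal J_s=\mathcal S$,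 and whenever $\mathcal J_s=\mathcal S$, the vector $x^s=z$ is the unique minimizer of $\|Aw-y\|_2^2$ over all $w$ with $\operatorname{supp}(w)\subseteq\mathcal J_s$. Let $$\mathcal D=\{A\in\mathcal U : A \text{ achieves exact vector recovery for the support } \mathcal S\},$$ $$\mathcal D'=\{A\in\mathcal D : \|(A_{\bullet\mathcal S}^TA_{\bullet\mathcal S})^{-1}A_{\bullet\mathcal S}^TA_{\bullet\mathcal S^c}\|_1=1\},$$ where $A_{\bullet\mathcal S}$ and $A_{\bullet\mathcal S^c}$ consist of the columns of $A$ with index in $\mathcal S$ and outside $\mathcal S$, and $\|\cdot\|_1$ is the matrix $1$-norm (the maximal absolute column sum, which is $0$ for a matrix without columns). Then: 1. $\mathcal D$ is measurable with respect to the completion of $\mu$, and $\mu(\mathcal D)>0$ if $|\mathcal S|<m$. 2. $\mu(\mathcal D')=0$. 3. Consequently the exact recovery condition is necessary for almost all matrices that achieve exact vector recovery: for $\mu$-almost every $A\in\mathcal D$, the matrix $A_{\bullet\mathcal S}$ has full column rank and $\|(A_{\bullet\mathcal S}^TA_{\bullet\mathcal S})^{-1}A_{\bullet\mathcal S}^TA_{\bullet\mathcal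 S^c}\|_1<1$. -/

import Mathlib

open MeasureTheory

/-- The squared Euclidean residual `‖y - A x‖₂²`. -/
noncomputable def residualSq {m N : ℕ} (A : Matrix (Fin m) (Fin N) ℝ) (y : Fin m → ℝ)
    (x : Fin N → ℝ) : ℝ :=
  ‖WithLp.toLp 2 (y - A.mulVec x)‖ ^ 2

/-- `j` is an optimal index at the current point `x`: with
`g i = min_t ‖y - A (x + t e_i)‖₂²` subject to `x + t e_i ∈ P`, the index `j` minimizes `g`. -/
def IsOptimalIndex {m N : ℕ} (A : Matrix (Fin m) (Fin N) ℝ) (y : Fin m → ℝ)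
    (P : Set (Fin N → ℝ)) (x : Fin N → ℝ) (j : Fin N) : Prop :=
  ∃ g : Fin N → ℝ,
    (∀ i, IsLeast
      {r : ℝ | ∃ t : ℝ, x + Pi.single i t ∈ P ∧ r = residualSq A y (x + Pi.single i t)} (g i)) ∧
    ∀ i, g j ≤ g i

/-- `w` is an optimal solution of `min ‖A w - y‖₂²` subject to `w ∈ P` and `supp w ⊆ J`. -/
def IsOptimalFit {m N : ℕ} (A : Matrix (Fin m) (Fin N) ℝ) (y : Fin m → ℝ)
    (P : Set (Fin N → ℝ)) (J : Finset (Fin N)) (w : Fin N → ℝ) : Prop :=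
  (w ∈ P ∧ Function.support w ⊆ (J : Set (Fin N))) ∧
    ∀ v ∈ P, Function.support v ⊆ (J : Set (Fin N)) → residualSq A y w ≤ residualSq A y v

/-- A sequence generated by constrained matching pursuit on `P` with data `A`, `y`.
Here `x k` is the iterate `x^k`, `J k` is the index set `J_k`, and `j k` is the index `j*_{k+1}`
that is selected in passing from step `k` to step `k + 1`; all ties are broken arbitrarily. -/
structure IsMatchingPursuitSeq {m N : ℕ} (A : Matrix (Fin m) (Fin N) ℝ) (y : Fin m → ℝ)
    (P : Set (Fin N → ℝ)) (x : ℕ → Fin N → ℝ) (j : ℕ → Fin N) (J : ℕ → Finset (Fin N)) :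
    Prop where
  x_zero : x 0 = 0
  J_zero : J 0 = ∅
  index : ∀ k, IsOptimalIndex A y P (x k) (j k)
  J_succ : ∀ k, J (k + 1) = J k ∪ {j k}
  x_succ : ∀ k, IsOptimalFit A y P (J (k + 1)) (x (k + 1))

/-- Exact support recovery of `z` from `y = A z`: every generated sequence attains
`J_s = supp z` at some step `s`. -/
def ExactSupportRecovery {m N : ℕ} (A : Matrix (Fin m) (Fin N) ℝ) (P : Set (Fin N → ℝ))
    (z : Fin N → ℝ) : Prop :=
  ∀ (x : ℕ → Fin N → ℝ) (j : ℕ → Fin N) (J : ℕ → Finset (Fin N)),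
    IsMatchingPursuitSeq A (A.mulVec z) P x j J →
      ∃ s, (J s : Set (Fin N)) = Function.support z

/-- Exact vector recovery of `z` from `y = A z`: exact support recovery holds and, along every
generated sequence, once `J_s = supp z`, the fitting problem on `J_s` has the unique solution
`x^s = z`. -/
def ExactVectorRecovery {m N : ℕ} (A : Matrix (Fin m) (Fin N) ℝ) (P : Set (Fin N → ℝ))
    (z : Fin N → ℝ) : Prop :=
  ExactSupportRecovery A P z ∧
    ∀ (x : ℕ → Fin N → ℝ) (j : ℕ → Fin N) (J : ℕ → Finset (Fin N)),
      IsMatchingPursuitSeq A (A.mulVec z) P x j J →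
        ∀ s, (J s : Set (Fin N)) = Function.support z →
          x s = z ∧ ∀ w, IsOptimalFit A (A.mulVec z) P (J s) w ↔ w = z

/-- Exact vector recovery on `P` for the fixed support `S`. -/
def ExactVectorRecoveryFor {m N : ℕ} (A : Matrix (Fin m) (Fin N) ℝ) (P : Set (Fin N → ℝ))
    (S : Finset (Fin N)) : Prop :=
  ∀ z ∈ P, Function.support z = (S : Set (Fin N)) → ExactVectorRecovery A P z

/-- The submatrix `A_S` of the columns with index in `S`. -/
def colsIn {m N : ℕ} (A : Matrix (Fin m) (Fin N) ℝ) (S : Finset (Fin N)) :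
    Matrix (Fin m) {j // j ∈ S} ℝ :=
  A.submatrix id Subtype.val

/-- The submatrix `A_{Sᶜ}` of the columns with index outside `S`. -/
def colsOut {m N : ℕ} (A : Matrix (Fin m) (Fin N) ℝ) (S : Finset (Fin N)) :
    Matrix (Fin m) {j // j ∉ S} ℝ :=
  A.submatrix id Subtype.val

/-- The matrix 1-norm: the maximal absolute column sum (`0` if there are no columns). -/
noncomputable def matrixOneNorm {ι κ : Type*} [Fintype ι] (M : Matrix ι κ ℝ) : ℝ :=
  ⨆ j, ∑ i, |M i j|

/-- The quantity `‖(A_Sᵀ A_S)⁻¹ A_Sᵀ A_{Sᶜ}‖₁` of the exact recovery condition. -/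
noncomputable def ercNorm {m N : ℕ} (A : Matrix (Fin m) (Fin N) ℝ) (S : Finset (Fin N)) : ℝ :=
  matrixOneNorm
    (((colsIn A S).transpose * colsIn A S)⁻¹ * (colsIn A S).transpose * colsOut A S)

/-- The set `U` of all `m × N` matrices with columns of Euclidean norm one. -/
def unitColumnMatrices (m N : ℕ) : Set (Matrix (Fin m) (Fin N) ℝ) :=
  {A | ∀ j, ‖WithLp.toLp 2 (A.col j)‖ = 1}

/-- The matrix whose columns are `N` given points of the unit sphere of `ℝ^m`. -/
def ofSphereColumns {m N : ℕ}
    (a : Fin N → Metric.sphere (0 : EuclideanSpace ℝ (Fin m)) 1) : Matrix (Fin m) (Fin N) ℝ :=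
  Matrix.of fun i j => (a j : EuclideanSpace ℝ (Fin m)) i

/-- Real matrices carry the entrywise product σ-algebra, which is the Borel one. -/
instance matrixMeasurableSpace (m N : ℕ) : MeasurableSpace (Matrix (Fin m) (Fin N) ℝ) :=
  inferInstanceAs (MeasurableSpace (Fin m → Fin N → ℝ))

/-- The surface (Lebesgue) measure on `U`, a product of `N` unit spheres of `ℝ^m`: the product of
the surface measures of the spheres, as a measure on all matrices that is carried by `U`. -/
noncomputable def unitColumnMeasure (m N : ℕ) : Measure (Matrix (Fin m) (Fin N) ℝ) :=
  Measure.map ofSphereColumns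
    (Measure.pi fun _ : Fin N => (volume : Measure (EuclideanSpace ℝ (Fin m))).toSphere)

/-- The set `D` of unit-column matrices that achieve exact vector recovery for the support `S`
by orthogonal matching pursuit, i.e. matching pursuit with constraint set `ℝ^N`. -/
def ompRecoverySet (m : ℕ) {N : ℕ} (S : Finset (Fin N)) : Set (Matrix (Fin m) (Fin N) ℝ) :=
  {A | A ∈ unitColumnMatrices m N ∧ ExactVectorRecoveryFor A Set.univ S}

/-- The set `D'` of those matrices in `D` whose exact recovery norm equals one. -/
def ompBorderlineSet (m : ℕ) {N : ℕ} (S : Finset (Fin N)) : Set (Matrix (Fin m) (Fin N) ℝ) :=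
  {A | A ∈ ompRecoverySet m S ∧ ercNorm A S = 1}

/-! For unit columns, OMP selects a column with the largest absolute correlation with the residual.
Let E consist of the unit-column matrices with invertible Gram matrix on S and ERC norm below 1; the
proof shows E ⊆ D ⊆ E ∪ D' and that D' is null.

Sufficiency: while J_k ⊆ S, the residual lies in the span of A_S, and correlations outside S are
combinations of those inside, with coefficients in a column of the ERC matrix. Column sums below 1
keep the choice in S (`exactVectorRecoveryFor_of_ercNorm_lt_one`).

Necessity up to equality: uniqueness of the fit forces full rank, and the first OMP step bounds
outside correlations by the largest inside one. Testing this against sign vectors bounds the ERC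
norm by 1 (`ercNorm_le_one_of_mem_ompRecoverySet`).

Null set: for m ≥ 2, with all columns but j ∉ S fixed, a column sum equal to 1 puts column j in
finitely many sets ⟪c, v⟫ = 1, each null on the sphere; Fubini concludes. For m ≤ 1, D' is empty.

Positivity: E is relatively open, and nonempty when |S| < m. -/

section Helpers

open Matrix

variable {m N : ℕ}

/-! ### Single OMP steps and the existence of OMP sequences -/

theorem residualSq_eq_dotProduct (A : Matrix (Fin m) (Fin N) ℝ) (y : Fin m → ℝ)
    (x : Fin N → ℝ) : residualSq A y x = (y - A *ᵥ x) ⬝ᵥ (y - A *ᵥ x) := by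
  rw [residualSq, EuclideanSpace.real_norm_sq_eq]
  simp [dotProduct, sq]

theorem col_dotProduct_self {A : Matrix (Fin m) (Fin N) ℝ} (hA : A ∈ unitColumnMatrices m N)
    (i : Fin N) : A.col i ⬝ᵥ A.col i = 1 := by
  have h := congrArg (· ^ 2) (hA i)
  simp only [EuclideanSpace.real_norm_sq_eq, one_pow] at h
  rw [← h]
  simp [dotProduct, sq]

theorem residualSq_add_single {A : Matrix (Fin m) (Fin N) ℝ} (hA : A ∈ unitColumnMatrices m N)
    (y : Fin m → ℝ) (x : Fin N → ℝ) (i : Fin N) (t : ℝ) :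
    residualSq A y (x + Pi.single i t) =
      residualSq A y x - 2 * t * (A.col i ⬝ᵥ (y - A *ᵥ x)) + t ^ 2 := by
  have h : y - A *ᵥ (x + Pi.single i t) = (y - A *ᵥ x) - t • A.col i := by
    ext k
    simp [mulVec_add, mulVec_single]
    ring
  rw [residualSq_eq_dotProduct, residualSq_eq_dotProduct, h]
  simp only [sub_dotProduct, dotProduct_sub, smul_dotProduct, dotProduct_smul,
    col_dotProduct_self hA, smul_eq_mul, dotProduct_comm _ (A.col i)]
  ring

theorem isOptimalIndex_iff {A : Matrix (Fin m) (Fin N) ℝ} (hA : A ∈ unitColumnMatrices m N)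
    (y : Fin m → ℝ) (x : Fin N → ℝ) (j : Fin N) :
    IsOptimalIndex A y Set.univ x j ↔
      ∀ i, |A.col i ⬝ᵥ (y - A *ᵥ x)| ≤ |A.col j ⬝ᵥ (y - A *ᵥ x)| := by
  have hleast : ∀ i, IsLeast
      {r : ℝ | ∃ t : ℝ, x + Pi.single i t ∈ (Set.univ : Set (Fin N → ℝ)) ∧
        r = residualSq A y (x + Pi.single i t)}
      (residualSq A y x - (A.col i ⬝ᵥ (y - A *ᵥ x)) ^ 2) := by
    intro i
    refine ⟨⟨A.col i ⬝ᵥ (y - A *ᵥ x), Set.mem_univ _, ?_⟩, ?_⟩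
    · rw [residualSq_add_single hA]
      ring
    · rintro r ⟨t, -, rfl⟩
      rw [residualSq_add_single hA]
      nlinarith [sq_nonneg (t - A.col i ⬝ᵥ (y - A *ᵥ x))]
  constructor
  · rintro ⟨g, hg, hj⟩ i
    have h := hj i
    rw [(hg i).unique (hleast i), (hg j).unique (hleast j)] at h
    exact sq_le_sq.mp (by linarith)
  · intro h
    refine ⟨_, hleast, fun i => ?_⟩
    have := sq_le_sq.mpr (h i)
    linarith

theorem exists_isOptimalIndex [Nonempty (Fin N)] {A : Matrix (Fin m) (Fin N) ℝ}
    (hA : A ∈ unitColumnMatrices m N) (y : Fin m → ℝ) (x : Fin N → ℝ) :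
    ∃ j, IsOptimalIndex A y Set.univ x j := by
  obtain ⟨j, hj⟩ := Finite.exists_max fun i => |A.col i ⬝ᵥ (y - A *ᵥ x)|
  exact ⟨j, (isOptimalIndex_iff hA y x j).mpr hj⟩

theorem IsOptimalFit.col_dotProduct_residual {A : Matrix (Fin m) (Fin N) ℝ}
    (hA : A ∈ unitColumnMatrices m N) {y : Fin m → ℝ} {J : Finset (Fin N)} {w : Fin N → ℝ}
    (hw : IsOptimalFit A y Set.univ J w) {i : Fin N} (hi : i ∈ J) :
    A.col i ⬝ᵥ (y - A *ᵥ w) = 0 := by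
  have h := hw.2 (w + Pi.single i (A.col i ⬝ᵥ (y - A *ᵥ w))) (Set.mem_univ _) ?_
  · rw [residualSq_add_single hA] at h
    nlinarith
  · intro k hk
    by_contra hkJ
    have hwk : w k = 0 := by
      by_contra h0
      exact hkJ (hw.1.2 h0)
    have hki : k ≠ i := fun h => hkJ (h ▸ hi)
    exact hk (by simp [hwk, hki])

/-- The image of a coordinate subspace is finite-dimensional, hence closed, so its distance to `y`
is attained even when the columns are dependent. -/
theorem exists_isOptimalFit (A : Matrix (Fin m) (Fin N) ℝ) (y : Fin m → ℝ)
    (J : Finset (Fin N)) : ∃ w, IsOptimalFit A y Set.univ J w := by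
  let V : Submodule ℝ (Fin N → ℝ) :=
    { carrier := {w | Function.support w ⊆ (J : Set (Fin N))}
      add_mem' := fun {a b} ha hb =>
        (Function.support_add a b).trans (Set.union_subset ha hb)
      zero_mem' := by simp
      smul_mem' := fun c a ha => (Function.support_const_smul_subset c a).trans ha }
  let f : (Fin N → ℝ) →ₗ[ℝ] EuclideanSpace ℝ (Fin m) :=
    (WithLp.linearEquiv 2 ℝ (Fin m → ℝ)).symm.toLinearMap ∘ₗ A.mulVecLin
  have hclosed : IsClosed (V.map f : Set (EuclideanSpace ℝ (Fin m))) :=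
    Submodule.closed_of_finiteDimensional _
  obtain ⟨u, hu, hmin⟩ :=
    hclosed.exists_infDist_eq_dist (Submodule.nonempty _) (WithLp.toLp 2 y)
  obtain ⟨w, hw, rfl⟩ := hu
  have hres : ∀ v, residualSq A y v = dist (WithLp.toLp 2 y) (f v) ^ 2 := fun v => by
    rw [dist_eq_norm]
    rfl
  refine ⟨w, ⟨Set.mem_univ _, hw⟩, fun v _ hv => ?_⟩
  rw [hres, hres, ← hmin]
  exact pow_le_pow_left₀ Metric.infDist_nonneg
    (Metric.infDist_le_dist_of_mem (Submodule.mem_map_of_mem hv)) 2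

/-- Every optimal first index extends to a sequence of orthogonal matching pursuit. -/
theorem exists_isMatchingPursuitSeq {A : Matrix (Fin m) (Fin N) ℝ}
    (hA : A ∈ unitColumnMatrices m N) (y : Fin m → ℝ) {j₀ : Fin N}
    (hj₀ : IsOptimalIndex A y Set.univ 0 j₀) :
    ∃ x j J, IsMatchingPursuitSeq A y Set.univ x j J ∧ j 0 = j₀ := by
  have : Nonempty (Fin N) := ⟨j₀⟩
  choose pick hpick using exists_isOptimalIndex hA y
  choose fit hfit using exists_isOptimalFit A y
  -- Optimality of an index depends only on the current point, so overriding the rule at 0 fixes the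
  -- first index and stays valid if an iterate returns to 0.
  let next : (Fin N → ℝ) → Fin N := Function.update pick 0 j₀
  have hnext : ∀ x, IsOptimalIndex A y Set.univ x (next x) := by
    intro x
    by_cases hx : x = 0
    · subst hx
      simpa [next] using hj₀
    · simpa [next, hx] using hpick x
  let step : (Fin N → ℝ) × Finset (Fin N) → (Fin N → ℝ) × Finset (Fin N) :=
    fun p => (fit (p.2 ∪ {next p.1}), p.2 ∪ {next p.1})
  let state : ℕ → (Fin N → ℝ) × Finset (Fin N) := fun k => step^[k] (0, ∅)
  have hstate : ∀ k, state (k + 1) = step (state k) :=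
    fun k => Function.iterate_succ_apply' step k _
  refine ⟨fun k => (state k).1, fun k => next (state k).1, fun k => (state k).2,
    ⟨rfl, rfl, fun k => hnext _, fun k => ?_, fun k => ?_⟩, ?_⟩
  · simp only [hstate, step]
  · simp only [hstate, step]
    exact hfit _
  · simp [state, next]

theorem IsMatchingPursuitSeq.index_mem {A : Matrix (Fin m) (Fin N) ℝ} {y : Fin m → ℝ}
    {P : Set (Fin N → ℝ)} {x : ℕ → Fin N → ℝ} {j : ℕ → Fin N} {J : ℕ → Finset (Fin N)}
    (h : IsMatchingPursuitSeq A y P x j J) (k : ℕ) : j 0 ∈ J (k + 1) := by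
  induction k with
  | zero => simp [h.J_succ]
  | succ k ih => rw [h.J_succ]; exact Finset.mem_union_left _ ih

/-! ### Gram matrix and exact recovery norm -/

/-- The Gram matrix `A_Sᵀ A_S`. -/
noncomputable def gramIn (A : Matrix (Fin m) (Fin N) ℝ) (S : Finset (Fin N)) :
    Matrix {j // j ∈ S} {j // j ∈ S} ℝ :=
  (colsIn A S)ᵀ * colsIn A S

/-- The matrix `(A_Sᵀ A_S)⁻¹ A_Sᵀ A_{Sᶜ}` of the exact recovery condition. -/
noncomputable def ercMatrix (A : Matrix (Fin m) (Fin N) ℝ) (S : Finset (Fin N)) :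
    Matrix {j // j ∈ S} {j // j ∉ S} ℝ :=
  (gramIn A S)⁻¹ * (colsIn A S)ᵀ * colsOut A S

theorem ercNorm_eq (A : Matrix (Fin m) (Fin N) ℝ) (S : Finset (Fin N)) :
    ercNorm A S = ⨆ j, ∑ i, |ercMatrix A S i j| := rfl

/-- A supremum over finitely many columns is attained, unless there are none; then it is 0, which
the hypothesis excludes. -/
theorem exists_colSum_eq_of_ercNorm_ne_zero {A : Matrix (Fin m) (Fin N) ℝ} {S : Finset (Fin N)}
    (h : ercNorm A S ≠ 0) : ∃ j, ∑ i, |ercMatrix A S i j| = ercNorm A S := by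
  rcases isEmpty_or_nonempty {j // j ∉ S} with hS | hS
  · exact absurd (by rw [ercNorm_eq, Real.iSup_of_isEmpty]) h
  · exact exists_eq_ciSup_of_finite

theorem ercNorm_le_one {A : Matrix (Fin m) (Fin N) ℝ} {S : Finset (Fin N)}
    (h : ∀ j, ∑ i, |ercMatrix A S i j| ≤ 1) : ercNorm A S ≤ 1 :=
  Real.iSup_le h zero_le_one

theorem ercNorm_lt_one_iff {A : Matrix (Fin m) (Fin N) ℝ} {S : Finset (Fin N)} :
    ercNorm A S < 1 ↔ ∀ j, ∑ i, |ercMatrix A S i j| < 1 := by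
  constructor
  · exact fun h j => (le_ciSup (Set.finite_range _).bddAbove j).trans_lt h
  · intro h
    by_cases h0 : ercNorm A S = 0
    · rw [h0]
      exact one_pos
    · obtain ⟨j, hj⟩ := exists_colSum_eq_of_ercNorm_ne_zero h0
      exact hj ▸ h j

theorem gramIn_mulVec_injective_iff {A : Matrix (Fin m) (Fin N) ℝ} {S : Finset (Fin N)} :
    Function.Injective (gramIn A S).mulVec ↔ Function.Injective (colsIn A S).mulVec := by
  rw [← coe_mulVecLin, ← coe_mulVecLin, ← LinearMap.ker_eq_bot, ← LinearMap.ker_eq_bot,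
    gramIn, ker_mulVecLin_transpose_mul_self]

theorem linearIndependent_colsIn_iff {A : Matrix (Fin m) (Fin N) ℝ} {S : Finset (Fin N)} :
    LinearIndependent ℝ (colsIn A S).col ↔ (gramIn A S).det ≠ 0 := by
  rw [← mulVec_injective_iff, ← gramIn_mulVec_injective_iff, mulVec_injective_iff_isUnit,
    isUnit_iff_isUnit_det, isUnit_iff_ne_zero]

theorem colsIn_mulVec_injective {A : Matrix (Fin m) (Fin N) ℝ} {S : Finset (Fin N)}
    (h : (gramIn A S).det ≠ 0) : Function.Injective (colsIn A S).mulVec :=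
  mulVec_injective_iff.mpr (linearIndependent_colsIn_iff.mpr h)

theorem ercMatrix_transpose_mul_gramIn {A : Matrix (Fin m) (Fin N) ℝ} {S : Finset (Fin N)}
    (h : (gramIn A S).det ≠ 0) :
    (ercMatrix A S)ᵀ * gramIn A S = (colsOut A S)ᵀ * colsIn A S := by
  have hsymm : (gramIn A S)ᵀ = gramIn A S := by simp [gramIn]
  rw [ercMatrix, transpose_mul, transpose_mul, transpose_nonsing_inv, hsymm, transpose_transpose,
    Matrix.mul_assoc, Matrix.mul_assoc, nonsing_inv_mul _ (isUnit_iff_ne_zero.mpr h),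
    Matrix.mul_one]

/-- Correlations with the columns outside `S` in terms of those with the columns in `S`. -/
theorem col_dotProduct_colsIn_mulVec {A : Matrix (Fin m) (Fin N) ℝ} {S : Finset (Fin N)}
    (h : (gramIn A S).det ≠ 0) (w : {j // j ∈ S} → ℝ) (j : {j // j ∉ S}) :
    A.col j ⬝ᵥ (colsIn A S *ᵥ w) =
      ∑ i, ercMatrix A S i j * (A.col i ⬝ᵥ (colsIn A S *ᵥ w)) := by
  have h1 := congrFun (congrArg (· *ᵥ w) (ercMatrix_transpose_mul_gramIn h)) j
  simp only [gramIn, ← mulVec_mulVec] at h1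
  exact h1.symm

theorem mulVec_eq_colsIn_mulVec (A : Matrix (Fin m) (Fin N) ℝ) {S : Finset (Fin N)}
    {v : Fin N → ℝ} (hv : Function.support v ⊆ (S : Set (Fin N))) :
    A *ᵥ v = colsIn A S *ᵥ fun i => v i := by
  ext k
  simp only [mulVec, dotProduct, colsIn, submatrix_apply, id]
  rw [Finset.sum_coe_sort S fun i => A k i * v i]
  refine (Finset.sum_subset (Finset.subset_univ S) fun i _ hi => ?_).symm
  have : v i = 0 := by
    by_contra h0
    exact hi (hv h0)
  simp [this]

theorem eq_of_mulVec_eq {A : Matrix (Fin m) (Fin N) ℝ} {S : Finset (Fin N)}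
    (h : (gramIn A S).det ≠ 0) {v w : Fin N → ℝ}
    (hv : Function.support v ⊆ (S : Set (Fin N))) (hw : Function.support w ⊆ (S : Set (Fin N)))
    (hvw : A *ᵥ v = A *ᵥ w) : v = w := by
  rw [mulVec_eq_colsIn_mulVec A hv, mulVec_eq_colsIn_mulVec A hw] at hvw
  have h1 := colsIn_mulVec_injective h hvw
  ext i
  by_cases hi : i ∈ S
  · exact congrFun h1 ⟨i, hi⟩
  · rw [Function.notMem_support.mp fun h => hi (hv h),
      Function.notMem_support.mp fun h => hi (hw h)]

theorem exists_extend (S : Finset (Fin N)) (w : {j // j ∈ S} → ℝ) :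
    ∃ v : Fin N → ℝ, Function.support v ⊆ (S : Set (Fin N)) ∧
      (fun i : {j // j ∈ S} => v i) = w := by
  refine ⟨fun i => if h : i ∈ S then w ⟨i, h⟩ else 0, fun i hi => ?_, ?_⟩
  · by_contra h
    exact hi (dif_neg h)
  · ext i
    simp

/-! ### Sufficiency of the exact recovery condition -/

/-- If the exact recovery norm is less than one, the columns best correlated with a nonzero vector
of the column span of `A_S` all belong to `S`. -/
theorem mem_of_forall_abs_col_dotProduct_le {A : Matrix (Fin m) (Fin N) ℝ} {S : Finset (Fin N)}
    (hdet : (gramIn A S).det ≠ 0) (herc : ercNorm A S < 1) {w : {j // j ∈ S} → ℝ}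
    {j : Fin N} (hw : A.col j ⬝ᵥ (colsIn A S *ᵥ w) ≠ 0)
    (hj : ∀ i, |A.col i ⬝ᵥ (colsIn A S *ᵥ w)| ≤ |A.col j ⬝ᵥ (colsIn A S *ᵥ w)|) : j ∈ S := by
  by_contra hjS
  have h1 := col_dotProduct_colsIn_mulVec hdet w ⟨j, hjS⟩
  have hpos := abs_pos.mpr hw
  have h2 : |A.col j ⬝ᵥ (colsIn A S *ᵥ w)| ≤
      (∑ i, |ercMatrix A S i ⟨j, hjS⟩|) * |A.col j ⬝ᵥ (colsIn A S *ᵥ w)| := by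
    conv_lhs => rw [h1]
    rw [Finset.sum_mul]
    refine (Finset.abs_sum_le_sum_abs _ _).trans (Finset.sum_le_sum fun i _ => ?_)
    rw [abs_mul]
    exact mul_le_mul_of_nonneg_left (hj i) (abs_nonneg _)
  have h3 := ercNorm_lt_one_iff.mp herc ⟨j, hjS⟩
  nlinarith

theorem residualSq_eq_zero_iff {A : Matrix (Fin m) (Fin N) ℝ} {y : Fin m → ℝ} {x : Fin N → ℝ} :
    residualSq A y x = 0 ↔ y = A *ᵥ x := by
  rw [residualSq_eq_dotProduct, dotProduct_self_eq_zero, sub_eq_zero]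

theorem isOptimalFit_iff_eq {A : Matrix (Fin m) (Fin N) ℝ} {S : Finset (Fin N)}
    (hdet : (gramIn A S).det ≠ 0) {z : Fin N → ℝ}
    (hz : Function.support z ⊆ (S : Set (Fin N))) (w : Fin N → ℝ) :
    IsOptimalFit A (A *ᵥ z) Set.univ S w ↔ w = z := by
  have h0 : residualSq A (A *ᵥ z) z = 0 := residualSq_eq_zero_iff.mpr rfl
  constructor
  · intro hw
    have h1 := hw.2 z (Set.mem_univ _) hz
    have h2 : residualSq A (A *ᵥ z) w = 0 := le_antisymm (h0 ▸ h1) (sq_nonneg _)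
    exact eq_of_mulVec_eq hdet hw.1.2 hz (residualSq_eq_zero_iff.mp h2).symm
  · rintro rfl
    exact ⟨⟨Set.mem_univ _, hz⟩, fun v _ _ => h0 ▸ sq_nonneg _⟩

/-- The exact recovery condition is sufficient for exact vector recovery. -/
theorem exactVectorRecoveryFor_of_ercNorm_lt_one {A : Matrix (Fin m) (Fin N) ℝ}
    {S : Finset (Fin N)} (hA : A ∈ unitColumnMatrices m N) (hdet : (gramIn A S).det ≠ 0)
    (herc : ercNorm A S < 1) : ExactVectorRecoveryFor A Set.univ S := by
  intro z _ hz
  refine ⟨fun x j J hseq => ?_, fun x j J hseq s hs => ?_⟩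
  · by_contra! hne
    have hcol : ∀ k, ∀ i ∈ J k, A.col i ⬝ᵥ (A *ᵥ z - A *ᵥ x k) = 0 := by
      rintro (_ | k) i hi
      · simp [hseq.J_zero] at hi
      · exact (hseq.x_succ k).col_dotProduct_residual hA hi
    have hsupp : ∀ k, Function.support (x k) ⊆ (J k : Set (Fin N)) := by
      rintro (_ | k)
      · simp [hseq.x_zero]
      · exact (hseq.x_succ k).1.2
    have hstep : ∀ k, J k ⊆ S → j k ∈ S ∧ j k ∉ J k := by
      intro k hk
      have hxS : Function.support (x k) ⊆ (S : Set (Fin N)) :=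
        (hsupp k).trans (Finset.coe_subset.mpr hk)
      have hzx : Function.support (z - x k) ⊆ (S : Set (Fin N)) :=
        (Function.support_sub z (x k)).trans (Set.union_subset hz.subset hxS)
      have hr : A *ᵥ z - A *ᵥ x k = colsIn A S *ᵥ fun i => (z - x k) i := by
        rw [← mulVec_sub, mulVec_eq_colsIn_mulVec A hzx]
      have hopt := (isOptimalIndex_iff hA _ _ _).mp (hseq.index k)
      -- If the best correlation vanished, all would; the Gram matrix would kill `z - x k`, so `x k
      -- = z` and `J k` would already equal `S`.
      have hne0 : A.col (j k) ⬝ᵥ (A *ᵥ z - A *ᵥ x k) ≠ 0 := by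
        intro h0
        simp only [h0, abs_zero, abs_nonpos_iff] at hopt
        have hgram : gramIn A S *ᵥ (fun i => (z - x k) i) = gramIn A S *ᵥ 0 := by
          rw [mulVec_zero, gramIn, ← mulVec_mulVec, ← hr]
          ext i
          exact hopt i
        have hzero := gramIn_mulVec_injective_iff.mpr (colsIn_mulVec_injective hdet) hgram
        have hxz : x k = z := by
          refine eq_of_mulVec_eq hdet hxS hz.subset ?_
          rw [hzero, mulVec_zero, sub_eq_zero] at hr
          exact hr.symm
        exact hne k (subset_antisymm ((Finset.coe_subset.mpr hk).trans hz.symm.subset)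
          (hxz ▸ hsupp k))
      refine ⟨?_, fun hmem => hne0 (hcol k _ hmem)⟩
      rw [hr] at hopt hne0
      exact mem_of_forall_abs_col_dotProduct_le hdet herc hne0 hopt
    -- If `S` is never reached, each step adds a new element of `S`, which is impossible after
    -- `S.card + 1` steps.
    have hcard : ∀ k, J k ⊆ S ∧ (J k).card = k := by
      intro k
      induction k with
      | zero => simp [hseq.J_zero]
      | succ k ih =>
        obtain ⟨h1, h2⟩ := hstep k ih.1
        rw [hseq.J_succ]
        refine ⟨Finset.union_subset ih.1 (Finset.singleton_subset_iff.mpr h1), ?_⟩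
        rw [Finset.card_union_of_disjoint (Finset.disjoint_singleton_right.mpr h2), ih.2,
          Finset.card_singleton]
    have := hcard (S.card + 1)
    have := Finset.card_le_card this.1
    omega
  · have hJ : J s = S := Finset.coe_injective (hs.trans hz)
    refine ⟨?_, fun w => hJ ▸ isOptimalFit_iff_eq hdet hz.subset w⟩
    rcases s with _ | s
    · rw [hseq.J_zero, Finset.coe_empty] at hs
      rw [hseq.x_zero, Function.support_eq_empty_iff.mp hs.symm]
    · exact (isOptimalFit_iff_eq hdet hz.subset _).mp (hJ ▸ hseq.x_succ s)

/-! ### Necessity up to equality -/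

theorem exists_isMatchingPursuitSeq_of_unitColumn [Nonempty (Fin N)]
    {A : Matrix (Fin m) (Fin N) ℝ} (hA : A ∈ unitColumnMatrices m N) (y : Fin m → ℝ) :
    ∃ x j J, IsMatchingPursuitSeq A y Set.univ x j J := by
  obtain ⟨j₀, hj₀⟩ := exists_isOptimalIndex hA y 0
  obtain ⟨x, j, J, h, -⟩ := exists_isMatchingPursuitSeq hA y hj₀
  exact ⟨x, j, J, h⟩

/-- A kernel vector supported in `S`, added to the indicator of `S`, gives another fit with zero
residual, so uniqueness makes it zero. -/
theorem gramIn_det_ne_zero_of_mem_ompRecoverySet {A : Matrix (Fin m) (Fin N) ℝ}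
    {S : Finset (Fin N)} (hA : A ∈ ompRecoverySet m S) : (gramIn A S).det ≠ 0 := by
  rcases isEmpty_or_nonempty {j // j ∈ S} with hS | ⟨⟨j₀, hj₀⟩⟩
  · simp
  have : Nonempty (Fin N) := ⟨j₀⟩
  rw [← linearIndependent_colsIn_iff, ← mulVec_injective_iff, ← coe_mulVecLin,
    injective_iff_map_eq_zero]
  intro w hw
  obtain ⟨v, hv, rfl⟩ := exists_extend S w
  rw [mulVecLin_apply, ← mulVec_eq_colsIn_mulVec A hv] at hw
  let z : Fin N → ℝ := fun i => if i ∈ S then 1 else 0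
  have hz : Function.support z = (S : Set (Fin N)) := by
    ext i
    simp [z]
  have hrec := hA.2 z (Set.mem_univ _) hz
  obtain ⟨x, j, J, hseq⟩ := exists_isMatchingPursuitSeq_of_unitColumn hA.1 (A *ᵥ z)
  obtain ⟨s, hs⟩ := hrec.1 x j J hseq
  have huniq := (hrec.2 x j J hseq s hs).2
  have hfit : IsOptimalFit A (A *ᵥ z) Set.univ (J s) (z + v) := by
    refine ⟨⟨Set.mem_univ _, ?_⟩, fun u _ _ => ?_⟩
    · rw [hs, hz]
      exact (Function.support_add z v).trans (Set.union_subset hz.subset hv)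
    · rw [residualSq_eq_zero_iff.mpr (by rw [mulVec_add, hw, add_zero])]
      exact sq_nonneg _
  have hv0 : v = 0 := by simpa using (huniq (z + v)).mp hfit
  subst hv0
  rfl

/-- Under exact vector recovery the column best correlated with `A z` lies in `S`, strictly. -/
theorem exists_abs_col_dotProduct_lt {A : Matrix (Fin m) (Fin N) ℝ} {S : Finset (Fin N)}
    (hA : A ∈ ompRecoverySet m S) (hS : S.Nonempty) {z : Fin N → ℝ}
    (hz : Function.support z = (S : Set (Fin N))) {j : Fin N} (hj : j ∉ S) :
    ∃ i ∈ S, |A.col j ⬝ᵥ (A *ᵥ z)| < |A.col i ⬝ᵥ (A *ᵥ z)| := by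
  have : Nonempty (Fin N) := ⟨j⟩
  have hfirst : ∀ i, IsOptimalIndex A (A *ᵥ z) Set.univ 0 i → i ∈ S := by
    intro i hi
    obtain ⟨x, j, J, hseq, rfl⟩ := exists_isMatchingPursuitSeq hA.1 _ hi
    obtain ⟨s, hs⟩ := (hA.2 z (Set.mem_univ _) hz).1 x j J hseq
    have hJ : J s = S := Finset.coe_injective (hs.trans hz)
    rcases s with _ | s
    · rw [hseq.J_zero] at hJ
      exact absurd hJ.symm hS.ne_empty
    · exact hJ ▸ hseq.index_mem s
  obtain ⟨i, hi⟩ := exists_isOptimalIndex hA.1 (A *ᵥ z) 0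
  refine ⟨i, hfirst i hi, ?_⟩
  -- Ties are broken arbitrarily: if `j` did at least as well as `i`, some OMP sequence would start
  -- with `j`, forcing `j ∈ S`.
  by_contra! hle
  have h1 := (isOptimalIndex_iff hA.1 _ _ _).mp hi
  refine hj (hfirst j ((isOptimalIndex_iff hA.1 _ _ _).mpr fun k => ?_))
  simp only [mulVec_zero, sub_zero] at h1 ⊢
  exact (h1 k).trans hle

/-- Recovery speaks only of vectors with full support on `S`. These are dense and both sides are
continuous, so the bound extends to every `w`; the sup norm on the right is the largest correlation
inside `S`. -/
theorem abs_col_dotProduct_le_norm {A : Matrix (Fin m) (Fin N) ℝ} {S : Finset (Fin N)}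
    (hA : A ∈ ompRecoverySet m S) (hS : S.Nonempty) {j : Fin N} (hj : j ∉ S)
    (w : {j // j ∈ S} → ℝ) :
    |A.col j ⬝ᵥ (colsIn A S *ᵥ w)| ≤ ‖gramIn A S *ᵥ w‖ := by
  have hdense : Dense (Set.univ.pi fun _ : {j // j ∈ S} => ({0}ᶜ : Set ℝ)) :=
    dense_pi _ fun _ _ => dense_compl_singleton 0
  have hclosed : IsClosed {w : {j // j ∈ S} → ℝ |
      |A.col j ⬝ᵥ (colsIn A S *ᵥ w)| ≤ ‖gramIn A S *ᵥ w‖} :=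
    isClosed_le (by fun_prop) (by fun_prop)
  have hsub : (Set.univ.pi fun _ : {j // j ∈ S} => ({0}ᶜ : Set ℝ)) ⊆
      {w | |A.col j ⬝ᵥ (colsIn A S *ᵥ w)| ≤ ‖gramIn A S *ᵥ w‖} := by
    intro w hw
    obtain ⟨z, hz, rfl⟩ := exists_extend S w
    have hz' : Function.support z = (S : Set (Fin N)) :=
      subset_antisymm hz fun i hi => hw ⟨i, hi⟩ (Set.mem_univ _)
    obtain ⟨i, hi, hlt⟩ := exists_abs_col_dotProduct_lt hA hS hz' hj
    rw [mulVec_eq_colsIn_mulVec A hz] at hlt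
    refine hlt.le.trans ?_
    rw [gramIn, ← mulVec_mulVec]
    exact norm_le_pi_norm ((colsIn A S)ᵀ *ᵥ (colsIn A S *ᵥ fun i => z i)) ⟨i, hi⟩
  exact closure_minimal hsub hclosed (hdense w)

theorem ercNorm_le_one_of_mem_ompRecoverySet {A : Matrix (Fin m) (Fin N) ℝ}
    {S : Finset (Fin N)} (hA : A ∈ ompRecoverySet m S) : ercNorm A S ≤ 1 := by
  refine ercNorm_le_one fun j => ?_
  rcases S.eq_empty_or_nonempty with hS | hS
  · subst hS
    simp
  have hdet := gramIn_det_ne_zero_of_mem_ompRecoverySet hA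
  -- The extremal vector of ℓ¹–ℓ^∞ duality: correlations `σ` inside `S` turn the correlation with
  -- column `j` into its absolute column sum.
  let σ : {j // j ∈ S} → ℝ := fun i => (SignType.sign (ercMatrix A S i j) : ℝ)
  have hσ : gramIn A S *ᵥ ((gramIn A S)⁻¹ *ᵥ σ) = σ := by
    rw [mulVec_mulVec, mul_nonsing_inv _ (isUnit_iff_ne_zero.mpr hdet), one_mulVec]
  have h1 := abs_col_dotProduct_le_norm hA hS j.2 ((gramIn A S)⁻¹ *ᵥ σ)
  have h2 : ∀ i : {j // j ∈ S},
      A.col i ⬝ᵥ (colsIn A S *ᵥ ((gramIn A S)⁻¹ *ᵥ σ)) = σ i := by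
    intro i
    have h := congrFun hσ i
    rw [gramIn, ← mulVec_mulVec] at h
    exact h
  rw [col_dotProduct_colsIn_mulVec hdet, hσ] at h1
  simp only [h2] at h1
  have h3 : ∀ i, ercMatrix A S i j * σ i = |ercMatrix A S i j| := fun i =>
    self_mul_sign _
  simp only [h3] at h1
  refine (le_abs_self _).trans (h1.trans ((pi_norm_le_iff_of_nonneg zero_le_one).mpr fun i => ?_))
  simp only [σ]
  cases SignType.sign (ercMatrix A S i j) <;> simp

/-- In dimension one all unit columns are ±1, so all correlations tie in absolute value, against the
strict inequality of the first step; in dimension zero there are no unit columns. -/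
theorem ercNorm_ne_one_of_mem_ompRecoverySet {A : Matrix (Fin m) (Fin N) ℝ}
    {S : Finset (Fin N)} (hm : m ≤ 1) (hA : A ∈ ompRecoverySet m S) : ercNorm A S ≠ 1 := by
  intro h1
  obtain ⟨j, hj⟩ := exists_colSum_eq_of_ercNorm_ne_zero (h1 ▸ one_ne_zero)
  rw [h1] at hj
  have hS : S.Nonempty := by
    rw [Finset.nonempty_iff_ne_empty]
    rintro rfl
    simp at hj
  let z : Fin N → ℝ := fun i => if i ∈ S then 1 else 0
  have hz : Function.support z = (S : Set (Fin N)) := by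
    ext i
    simp [z]
  obtain ⟨i, -, hlt⟩ := exists_abs_col_dotProduct_lt hA hS hz j.2
  have hi := col_dotProduct_self hA.1 i
  have hj' := col_dotProduct_self hA.1 j
  obtain rfl | rfl : m = 0 ∨ m = 1 := by omega
  · simp at hi
  · simp only [dotProduct, Finset.univ_unique, Finset.sum_singleton, ← sq, abs_mul] at hi hj' hlt
    rw [(sq_eq_sq_iff_abs_eq_abs _ _).mp (hi.trans hj'.symm)] at hlt
    exact lt_irrefl _ hlt

/-! ### Null sets on the sphere -/

/-- The cone `‖x‖ = ⟪c, x⟫` is a null set in dimension at least two. -/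
theorem volume_norm_eq_inner_eq_zero (hm : 2 ≤ m) (c : EuclideanSpace ℝ (Fin m)) :
    volume {x : EuclideanSpace ℝ (Fin m) | ‖x‖ = inner ℝ c x} = 0 := by
  have hconv : Convex ℝ {x : EuclideanSpace ℝ (Fin m) | ‖x‖ ≤ inner ℝ c x} := by
    intro x hx y hy a b ha hb _
    simp only [Set.mem_ofPred_eq] at hx hy ⊢
    rw [inner_add_right, real_inner_smul_right, real_inner_smul_right]
    refine (norm_add_le _ _).trans ?_
    rw [norm_smul_of_nonneg ha, norm_smul_of_nonneg hb]
    gcongr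
  refine measure_mono_null (fun x hx => ?_) (hconv.addHaar_frontier volume)
  -- Moving from `x` along `d ⟂ c`, with `d` signed so that ⟪x, d⟫ ≥ 0, increases the norm but not
  -- ⟪c, x⟫. So `x` is a frontier point of the convex set, whose frontier is null.
  obtain ⟨d, hd, hd0⟩ : ∃ d ∈ (ℝ ∙ c)ᗮ, d ≠ 0 := by
    refine Submodule.exists_mem_ne_zero_of_ne_bot fun hbot => ?_
    have h1 := Submodule.finrank_add_finrank_orthogonal (ℝ ∙ c)
    have h2 := (finrank_span_le_card (R := ℝ) {c}).trans_eq (by simp : _ = 1)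
    rw [hbot, finrank_bot, finrank_euclideanSpace_fin] at h1
    omega
  rw [Submodule.mem_orthogonal_singleton_iff_inner_right] at hd
  wlog hdx : 0 ≤ inner ℝ x d generalizing d
  · exact this (-d) (by simp [hd]) (neg_ne_zero.mpr hd0) (by rw [inner_neg_right]; linarith)
  have hx' : ‖x‖ = inner ℝ c x := hx
  rw [frontier_eq_closure_inter_closure]
  refine ⟨subset_closure hx'.le, ?_⟩
  have hlim : Filter.Tendsto (fun t : ℝ => x + t • d) (nhdsWithin 0 (Set.Ioi 0)) (nhds x) := by
    have : Continuous fun t : ℝ => x + t • d := by fun_prop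
    simpa using (this.tendsto 0).mono_left nhdsWithin_le_nhds
  refine mem_closure_of_tendsto hlim (Filter.eventually_of_mem self_mem_nhdsWithin fun t ht => ?_)
  simp only [Set.mem_compl_iff, Set.mem_ofPred_eq, not_le]
  rw [inner_add_right, real_inner_smul_right, hd, mul_zero, add_zero, ← hx']
  have ht0 : 0 < t := ht
  refine lt_of_pow_lt_pow_left₀ 2 (norm_nonneg _) ?_
  rw [norm_add_sq_real, real_inner_smul_right, norm_smul, mul_pow, Real.norm_eq_abs, sq_abs]
  have : 0 < t ^ 2 * ‖d‖ ^ 2 := by positivity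
  have : 0 ≤ t * inner ℝ x d := by positivity
  linarith

/-- The surface measure of a set is a multiple of the volume of the truncated cone over it, here
contained in ‖x‖ = ⟪c, x⟫. -/
theorem toSphere_inner_eq_one_eq_zero (hm : 2 ≤ m) (c : EuclideanSpace ℝ (Fin m)) :
    (volume : Measure (EuclideanSpace ℝ (Fin m))).toSphere
      {v | inner ℝ c (v : EuclideanSpace ℝ (Fin m)) = 1} = 0 := by
  rw [Measure.toSphere_apply' _ (measurableSet_eq_fun (by fun_prop) measurable_const)]
  refine mul_eq_zero_of_right _ (measure_mono_null ?_ (volume_norm_eq_inner_eq_zero hm c))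
  rintro _ ⟨t, ht, _, ⟨v, hv, rfl⟩, rfl⟩
  have hv' : inner ℝ c (v : EuclideanSpace ℝ (Fin m)) = 1 := hv
  simp [norm_smul, real_inner_smul_right, hv', abs_of_pos ht.1]

/-- For each of the finitely many sign patterns, the sum of absolute values is a single linear form.
-/
theorem toSphere_sum_abs_inner_eq_one_eq_zero {ι : Type*} [Fintype ι] (hm : 2 ≤ m)
    (p : ι → EuclideanSpace ℝ (Fin m)) :
    (volume : Measure (EuclideanSpace ℝ (Fin m))).toSphere
      {v | ∑ i, |inner ℝ (p i) (v : EuclideanSpace ℝ (Fin m))| = 1} = 0 := by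
  have hcount : Countable (ι → SignType) := Finite.to_countable
  refine measure_mono_null (fun v hv => ?_) (measure_iUnion_null fun σ : ι → SignType =>
    toSphere_inner_eq_one_eq_zero hm (∑ i, (σ i : ℝ) • p i))
  refine Set.mem_iUnion.mpr
    ⟨fun i => SignType.sign (inner ℝ (p i) (v : EuclideanSpace ℝ (Fin m))), ?_⟩
  simp only [Set.mem_ofPred_eq, sum_inner, real_inner_smul_left, sign_mul_self]
  exact hv

/-! ### Continuity and measurability in the matrix -/

instance matrixOpensMeasurableSpace : OpensMeasurableSpace (Matrix (Fin m) (Fin N) ℝ) :=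
  inferInstanceAs (OpensMeasurableSpace (Fin m → Fin N → ℝ))

theorem continuous_ofSphereColumns :
    Continuous (ofSphereColumns : (Fin N → _) → Matrix (Fin m) (Fin N) ℝ) := by
  refine continuous_matrix fun i j => ?_
  simp only [ofSphereColumns, of_apply]
  fun_prop

theorem measurable_ofSphereColumns :
    Measurable (ofSphereColumns : (Fin N → _) → Matrix (Fin m) (Fin N) ℝ) := by
  refine measurable_pi_lambda _ fun i => measurable_pi_lambda _ fun j => ?_
  simp only [ofSphereColumns, of_apply]
  fun_prop

theorem ofSphereColumns_mem_unitColumnMatrices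
    (a : Fin N → Metric.sphere (0 : EuclideanSpace ℝ (Fin m)) 1) :
    ofSphereColumns a ∈ unitColumnMatrices m N := by
  intro j
  exact norm_eq_of_mem_sphere (a j)

theorem continuous_colsIn (S : Finset (Fin N)) :
    Continuous fun A : Matrix (Fin m) (Fin N) ℝ => colsIn A S :=
  continuous_id.matrix_submatrix _ _

theorem continuous_colsOut (S : Finset (Fin N)) :
    Continuous fun A : Matrix (Fin m) (Fin N) ℝ => colsOut A S :=
  continuous_id.matrix_submatrix _ _

theorem continuous_gramIn (S : Finset (Fin N)) :
    Continuous fun A : Matrix (Fin m) (Fin N) ℝ => gramIn A S :=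
  (continuous_colsIn S).matrix_transpose.matrix_mul (continuous_colsIn S)

/-- Each entry of the matrix of the exact recovery condition is a quotient of polynomials. -/
theorem ercMatrix_apply (A : Matrix (Fin m) (Fin N) ℝ) (S : Finset (Fin N))
    (i : {j // j ∈ S}) (j : {j // j ∉ S}) :
    ercMatrix A S i j =
      (gramIn A S).det⁻¹ * ((gramIn A S).adjugate * (colsIn A S)ᵀ * colsOut A S) i j := by
  simp [ercMatrix, inv_def]

theorem continuous_adjugate_mul (S : Finset (Fin N)) (i : {j // j ∈ S}) (j : {j // j ∉ S}) :
    Continuous fun A : Matrix (Fin m) (Fin N) ℝ =>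
      ((gramIn A S).adjugate * (colsIn A S)ᵀ * colsOut A S) i j :=
  (((continuous_gramIn S).matrix_adjugate.matrix_mul
    (continuous_colsIn S).matrix_transpose).matrix_mul (continuous_colsOut S)).matrix_elem i j

/-- Real inversion with `0⁻¹ = 0` is measurable everywhere, so singular Gram matrices need no
separate case. -/
theorem measurable_colSum (S : Finset (Fin N)) (j : {j // j ∉ S}) :
    Measurable fun A : Matrix (Fin m) (Fin N) ℝ => ∑ i, |ercMatrix A S i j| := by
  simp only [ercMatrix_apply]
  refine Finset.measurable_sum _ fun i _ => Measurable.abs ?_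
  exact (continuous_gramIn S).matrix_det.measurable.inv.mul
    (continuous_adjugate_mul S i j).measurable

theorem isOpen_ercSet (S : Finset (Fin N)) :
    IsOpen {A : Matrix (Fin m) (Fin N) ℝ | (gramIn A S).det ≠ 0 ∧ ercNorm A S < 1} := by
  simp only [ercNorm_lt_one_iff]
  have hU : IsOpen {A : Matrix (Fin m) (Fin N) ℝ | (gramIn A S).det ≠ 0} :=
    isOpen_ne_fun (continuous_gramIn S).matrix_det continuous_const
  rw [isOpen_iff_mem_nhds]
  rintro A ⟨hA, hlt⟩
  refine Filter.inter_mem (hU.mem_nhds hA) (Filter.eventually_all.mpr fun j => ?_)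
  refine ContinuousAt.eventually_lt ?_ continuousAt_const (hlt j)
  simp only [ercMatrix_apply]
  refine tendsto_finsetSum _ fun i _ => (ContinuousAt.mul ?_ ?_).abs
  · exact (continuous_gramIn S).matrix_det.continuousAt.inv₀ hA
  · exact (continuous_adjugate_mul S i j).continuousAt

theorem measurableSet_unitColumnMatrices : MeasurableSet (unitColumnMatrices m N) := by
  simp only [unitColumnMatrices, Set.ofPred_forall]
  refine (isClosed_iInter fun j => isClosed_eq ?_ continuous_const).measurableSet
  refine ((PiLp.continuous_toLp 2 _).comp ?_).norm
  exact continuous_pi fun i => continuous_id.matrix_elem i j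

/-! ### The borderline set is null -/

theorem colsIn_ofSphereColumns_insertNth {n : ℕ} {S : Finset (Fin (n + 1))} {j : Fin (n + 1)}
    (hj : j ∉ S) (v v' : Metric.sphere (0 : EuclideanSpace ℝ (Fin m)) 1)
    (b : Fin n → Metric.sphere (0 : EuclideanSpace ℝ (Fin m)) 1) :
    colsIn (ofSphereColumns (j.insertNth v b)) S =
      colsIn (ofSphereColumns (j.insertNth v' b)) S := by
  ext k ⟨i, hi⟩
  obtain ⟨l, rfl⟩ := Fin.exists_succAbove_eq (x := i) (y := j) fun h => hj (h ▸ hi)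
  simp [colsIn, ofSphereColumns]

/-- With the other columns fixed, the column sum of the exact recovery matrix at `j ∉ S` depends on
the column `j` as a sum of absolute values of linear forms. -/
theorem ercMatrix_ofSphereColumns_insertNth {n : ℕ} {S : Finset (Fin (n + 1))} {j : Fin (n + 1)}
    (hj : j ∉ S) (v v' : Metric.sphere (0 : EuclideanSpace ℝ (Fin m)) 1)
    (b : Fin n → Metric.sphere (0 : EuclideanSpace ℝ (Fin m)) 1) (i : {j // j ∈ S}) :
    ercMatrix (ofSphereColumns (j.insertNth v b)) S i ⟨j, hj⟩ =
      inner ℝ (WithLp.toLp 2 (((gramIn (ofSphereColumns (j.insertNth v' b)) S)⁻¹ *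
        (colsIn (ofSphereColumns (j.insertNth v' b)) S)ᵀ) i))
        (v : EuclideanSpace ℝ (Fin m)) := by
  rw [ercMatrix, gramIn, colsIn_ofSphereColumns_insertNth hj v v' b, ← gramIn, mul_apply,
    PiLp.inner_apply]
  refine Finset.sum_congr rfl fun k _ => ?_
  simp [colsOut, ofSphereColumns, mul_comm]

theorem unitColumnMeasure_colSum_eq_one (hm : 2 ≤ m) (S : Finset (Fin N)) (j : {j // j ∉ S}) :
    unitColumnMeasure m N {A | ∑ i, |ercMatrix A S i j| = 1} = 0 := by
  obtain ⟨j, hj⟩ := j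
  obtain ⟨n, rfl⟩ : ∃ n, N = n + 1 := ⟨N - 1, by have := j.pos; omega⟩
  have hmeas : MeasurableSet
      {A : Matrix (Fin m) (Fin (n + 1)) ℝ | ∑ i, |ercMatrix A S i ⟨j, hj⟩| = 1} :=
    measurableSet_eq_fun (measurable_colSum S _) measurable_const
  have hpre := measurable_ofSphereColumns hmeas
  have hmp := (measurePreserving_piFinSuccAbove (fun _ : Fin (n + 1) =>
    (volume : Measure (EuclideanSpace ℝ (Fin m))).toSphere) j).symm
  rw [unitColumnMeasure, Measure.map_apply measurable_ofSphereColumns hmeas,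
    ← hmp.measure_preimage hpre.nullMeasurableSet, Measure.prod_apply_symm (hmp.measurable hpre)]
  refine (lintegral_congr fun b => ?_).trans lintegral_zero
  by_contra hne
  -- A reference value for column `j`: since `j ∉ S`, it does not affect the coefficients, and it
  -- lets them be written without the variable `v`.
  obtain ⟨v', -⟩ := nonempty_of_measure_ne_zero hne
  refine hne (measure_mono_null (fun v hv => ?_) (toSphere_sum_abs_inner_eq_one_eq_zero hm
    fun i => WithLp.toLp 2 (((gramIn (ofSphereColumns (j.insertNth v' b)) S)⁻¹ *
        (colsIn (ofSphereColumns (j.insertNth v' b)) S)ᵀ) i)))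
  simp only [Set.mem_ofPred_eq, ← ercMatrix_ofSphereColumns_insertNth hj v v' b]
  exact hv

theorem unitColumnMeasure_ercNorm_eq_one (hm : 2 ≤ m) (S : Finset (Fin N)) :
    unitColumnMeasure m N {A | ercNorm A S = 1} = 0 := by
  refine measure_mono_null (fun A hA => ?_)
    (measure_iUnion_null fun j => unitColumnMeasure_colSum_eq_one hm S j)
  have h1 : ercNorm A S = 1 := hA
  obtain ⟨j, hj⟩ := exists_colSum_eq_of_ercNorm_ne_zero (h1 ▸ one_ne_zero)
  exact Set.mem_iUnion.mpr ⟨j, hj.trans h1⟩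

theorem unitColumnMeasure_ompBorderlineSet (m : ℕ) (S : Finset (Fin N)) :
    unitColumnMeasure m N (ompBorderlineSet m S) = 0 := by
  rcases le_or_gt 2 m with hm | hm
  · exact measure_mono_null (fun A hA => hA.2) (unitColumnMeasure_ercNorm_eq_one hm S)
  · refine measure_mono_null (fun A hA => ?_) measure_empty
    exact ercNorm_ne_one_of_mem_ompRecoverySet (by omega) hA.1 hA.2

/-! ### Measurability and positive measure of the recovery set -/

theorem setOf_ercNorm_lt_one_subset_ompRecoverySet (m : ℕ) (S : Finset (Fin N)) :
    unitColumnMatrices m N ∩ {A | (gramIn A S).det ≠ 0 ∧ ercNorm A S < 1} ⊆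
      ompRecoverySet m S :=
  fun _ hA => ⟨hA.1, exactVectorRecoveryFor_of_ercNorm_lt_one hA.1 hA.2.1 hA.2.2⟩

theorem ompRecoverySet_diff_subset (m : ℕ) (S : Finset (Fin N)) :
    ompRecoverySet m S \ (unitColumnMatrices m N ∩ {A | (gramIn A S).det ≠ 0 ∧ ercNorm A S < 1}) ⊆
      ompBorderlineSet m S := by
  rintro A ⟨hA, hnot⟩
  refine ⟨hA, le_antisymm (ercNorm_le_one_of_mem_ompRecoverySet hA) (not_lt.mp fun hlt => ?_)⟩
  exact hnot ⟨hA.1, gramIn_det_ne_zero_of_mem_ompRecoverySet hA, hlt⟩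

theorem nullMeasurableSet_ompRecoverySet (m : ℕ) (S : Finset (Fin N)) :
    NullMeasurableSet (ompRecoverySet m S) (unitColumnMeasure m N) := by
  have hmeas := (measurableSet_unitColumnMatrices (m := m) (N := N)).inter
    (isOpen_ercSet S).measurableSet
  have hdiff := measure_mono_null (ompRecoverySet_diff_subset m S)
    (unitColumnMeasure_ompBorderlineSet m S)
  rw [← Set.union_sdiff_cancel (setOf_ercNorm_lt_one_subset_ompRecoverySet m S)]
  exact hmeas.nullMeasurableSet.union (NullMeasurableSet.of_null hdiff)

/-- If `S` has fewer than `m` elements, some matrix has orthonormal columns in `S` and its other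
columns orthogonal to these. -/
theorem exists_ofSphereColumns_ercNorm_lt_one {S : Finset (Fin N)} (hS : S.card < m) :
    ∃ a : Fin N → Metric.sphere (0 : EuclideanSpace ℝ (Fin m)) 1,
      (gramIn (ofSphereColumns a) S).det ≠ 0 ∧ ercNorm (ofSphereColumns a) S < 1 := by
  have hcard : Fintype.card {j // j ∈ S} ≤ Fintype.card (Fin S.card) := by simp
  obtain ⟨f⟩ := Function.Embedding.nonempty_of_card_le hcard
  -- `S` goes injectively to the first `S.card` basis vectors and every other index to the next one,
  -- which exists because `S.card < m`.
  let e : Fin N → Fin m := fun i =>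
    if h : i ∈ S then (f ⟨i, h⟩).castLE hS.le else ⟨S.card, hS⟩
  have hin : ∀ i : {j // j ∈ S}, e i = (f i).castLE hS.le := fun i => by simp [e]
  have hout : ∀ i : {j // j ∉ S}, e i = ⟨S.card, hS⟩ := fun i => by simp [e, i.2]
  let a : Fin N → Metric.sphere (0 : EuclideanSpace ℝ (Fin m)) 1 := fun i =>
    ⟨EuclideanSpace.single (e i) 1, by simp⟩
  have hgram : gramIn (ofSphereColumns a) S = 1 := by
    ext i k
    simp [gramIn, colsIn, ofSphereColumns, mul_apply, a, one_apply, hin, eq_comm]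
  have hcross : (colsIn (ofSphereColumns a) S)ᵀ * colsOut (ofSphereColumns a) S = 0 := by
    ext i k
    have hne : ⟨S.card, hS⟩ ≠ (f i).castLE hS.le := fun h =>
      (f i).isLt.ne' (congrArg Fin.val h)
    simp [colsIn, colsOut, ofSphereColumns, mul_apply, a, hin, hout, hne]
  refine ⟨a, by simp [hgram], ercNorm_lt_one_iff.mpr fun j => ?_⟩
  simp [ercMatrix, Matrix.mul_assoc, hcross]

theorem unitColumnMeasure_ompRecoverySet_pos {S : Finset (Fin N)} (hS : S.card < m) :
    0 < unitColumnMeasure m N (ompRecoverySet m S) := by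
  have hmeas := (measurableSet_unitColumnMatrices (m := m) (N := N)).inter
    (isOpen_ercSet S).measurableSet
  refine lt_of_lt_of_le ?_ (measure_mono (setOf_ercNorm_lt_one_subset_ompRecoverySet m S))
  rw [unitColumnMeasure, Measure.map_apply measurable_ofSphereColumns hmeas]
  obtain ⟨a, ha⟩ := exists_ofSphereColumns_ercNorm_lt_one hS
  have : (Measure.pi fun _ : Fin N =>
      (volume : Measure (EuclideanSpace ℝ (Fin m))).toSphere).IsOpenPosMeasure :=
    Measure.pi.isOpenPosMeasure _
  refine lt_of_lt_of_le (((isOpen_ercSet S).preimage continuous_ofSphereColumns).measure_pos _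
    ⟨a, ha⟩) (measure_mono fun b hb => ?_)
  exact ⟨ofSphereColumns_mem_unitColumnMatrices b, hb⟩

end Helpers

theorem mainTheorem10 (m N : ℕ) (S : Finset (Fin N)) :
    NullMeasurableSet (ompRecoverySet m S) (unitColumnMeasure m N) ∧
    (S.card < m → 0 < unitColumnMeasure m N (ompRecoverySet m S)) ∧
    unitColumnMeasure m N (ompBorderlineSet m S) = 0 ∧
    ∀ᵐ A ∂(unitColumnMeasure m N), A ∈ ompRecoverySet m S →
      LinearIndependent ℝ (colsIn A S).col ∧ ercNorm A S < 1 := by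
  refine ⟨nullMeasurableSet_ompRecoverySet m S, unitColumnMeasure_ompRecoverySet_pos,
    unitColumnMeasure_ompBorderlineSet m S, ?_⟩
  filter_upwards [measure_eq_zero_iff_ae_notMem.mp (unitColumnMeasure_ompBorderlineSet m S)]
    with A hA hrec
  exact ⟨linearIndependent_colsIn_iff.mpr (gramIn_det_ne_zero_of_mem_ompRecoverySet hrec),
    (ercNorm_le_one_of_mem_ompRecoverySet hrec).lt_of_ne fun h => hA ⟨hrec, h⟩⟩
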